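/- **Setting.** Let $D$ be $\mathbb Z$, $\mathbb Q$ or $\mathbb R$. A *literal* over a set $X$ of variables is $e\odot e'$ with $\odot\in\{=,\neq,<,\le\}$ and $e,e'$ expressions built from variables in $X$ and constants in $D$ by $+$ and $-$; a *constraint* is a finite conjunction of literals. Formulas are first-order formulas whose atoms are literals. They are interpreted in $D$, and $\equiv$ is logical equivalence over $D$. (Constants are taken from a countable set $S\subseteq D$ with a fixed injective coding by natural numbers, so that formulas can be coded by natural numbers.) A *DDSA* $\mathcal B=\langle B,b_0,A,T,F,V,\alpha_0,\mathrm{guard}\rangle$ consists of a finite set $B$ of states with initial state $b_0\in B$ and final states $F\subseteq B$, a finite set $A$ of actions, a (possibly partial) transition function $T: B\times A\rightharpoonup B$ (write $b\xrightarrow{a}b'$ for $T(b,a)=b'$), a finite set $V$ of variables, an initial assignment $\alpha_0: V\to D$, and for each action $a$ a constraint $\mathrm{guard}(a)$ over $V^r\cup V^w$, two disjoint copies of $V$. Let $\mathrm{write}(a)$ be the set of $v\in V$ such that $v^w$ occurs in $\mathrm{guard}(a)$, and $$\Delta_a(V^r,V^w)=\mathrm{guard}(a)\wedge\bigwedge_{v\notin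 \mathrm{write}(a)}v^w=v^r,\qquad \mathrm{update}(\varphi,a)=\exists U.\ \varphi(U)\wedge\Delta_a(U,V).$$ Let $\mathcal C$ be a finite set of constraints over $V$. A *symbolic run* $\sigma$ of length $n$ is a sequence $b_0\xrightarrow{a_1}b_1\cdots\xrightarrow{a_n}b_n$, and a *verification constraint sequence* for it is $\mathbf C=\langle C_0,\dots,C_n\rangle$ with all $C_i\subseteq\mathcal C$. The *history constraint* $h(\sigma,\mathbf C)$ is $\bigwedge_{v\in V} v=\alpha_0(v)\wedge\bigwedge C_0$ if $n=0$, and $\mathrm{update}(h(\sigma|_{n-1},\mathbf C|_{n-1}),a_n)\wedge\bigwedge C_n$ if $n>0$, where $|_{n-1}$ removes the last step, respectively the last set. **Feedback freedom.** Given $\sigma$ and $\mathbf C$ as above, the *computation graph* $G_{\sigma,\mathbf C}$ is the undirected graph on the nodes $v_i$ ($v\in V$, $0\le i\le n$) in which two distinct nodes are adjacent iff they occur in a common literal of $\Delta_{a_k}(V_{k-1},V_k)\wedge\bigwedge C_k(V_k)$ for some $1\le k\le n$. Let $[x_i]$ be the class of $x_i$ under the smallest equivalence relation that relates $u_i$ and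 $v_j$ whenever $u_i=v_j$ is one of these literals, and let $\mathrm{span}([x_i])=\{j\mid \exists v\in V,\ v_j\in[x_i]\}$. The pair $(\mathcal B,\mathcal C)$ is *feedback-free* if for every symbolic run $\sigma$, every verification constraint sequence $\mathbf C$ over $\mathcal C$ of matching length, every $x\in V$ and all $i,j$, each path in $G_{\sigma,\mathbf C}$ from $x_i$ to $x_j$ contains a node $y$ with $\mathrm{span}([x_i])\cup \mathrm{span}([x_j])\subseteq \mathrm{span}([y])$. **Finite summary.** A *history set* for $(\mathcal B,\mathcal C)$ is a set $\Phi$ of pairs $(b,\varphi)$ of a state and a formula with free variables in $V$ such that for every $\sigma$ with final state $b$ and every $\mathbf C$ there is $(b,\varphi)\in\Phi$ with $h(\sigma,\mathbf C)\equiv\varphi$, and every pair in $\Phi$ arises in this way from some $\sigma$ and $\mathbf C$. A *summary* is a pair $(\Phi,\sim)$ of a history set $\Phi$ and an equivalence relation $\sim$ on the formulas occurring in $\Phi$ such that 1. $\varphi\equiv\psi$ implies $\varphi\sim\psi$, and $\sim$ is decidable (there is a computable function of two codes that decides $\varphi\sim\psi$ for all formulas $\varphi,\psi$ occurring in $\Phi$);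 2. for all $(b,\varphi),(b,\psi)\in\Phi$ with $\varphi\sim\psi$: (a) $\varphi$ is satisfiable iff $\psi$ is; (b) for every $b\xrightarrow{a}b'$ and $C\subseteq\mathcal C$ there are $(b',\varphi'),(b',\psi')\in\Phi$ with $\varphi'\equiv \mathrm{update}(\varphi,a)\wedge\bigwedge C$, $\psi'\equiv \mathrm{update}(\psi,a)\wedge\bigwedge C$ and $\varphi'\sim\psi'$. $(\mathcal B,\mathcal C)$ *has finite summary* if it has a summary $(\Phi,\sim)$ such that $\sim$ has finitely many equivalence classes. **Theorem.** If $(\mathcal B,\mathcal C)$ is feedback-free, then it has finite summary. -/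

import Mathlib

universe u v w z

namespace DDSA

open FirstOrder FirstOrder.Language

/-! ### Linear arithmetic constraints -/

/-- Expressions `e := v | k | e + e | e - e` over variables `X` and constants `K`. -/
inductive Expr (K : Type u) (X : Type v) : Type (max u v)
  | var (x : X)
  | const (k : K)
  | add (e₁ e₂ : Expr K X)
  | sub (e₁ e₂ : Expr K X)

namespace Expr

variable {K : Type u} {X : Type v} {Y : Type w}

/-- The variables occurring in an expression. -/
def vars : Expr K X → Set X
  | var x => {x}
  | const _ => ∅
  | add e₁ e₂ => e₁.vars ∪ e₂.vars
  | sub e₁ e₂ => e₁.vars ∪ e₂.vars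

/-- Renaming of variables. -/
def map (f : X → Y) : Expr K X → Expr K Y
  | var x => var (f x)
  | const k => const k
  | add e₁ e₂ => add (e₁.map f) (e₂.map f)
  | sub e₁ e₂ => sub (e₁.map f) (e₂.map f)

end Expr

/-- The four comparison symbols. -/
inductive Cmp
  | eq
  | ne
  | lt
  | le

/-- A literal `e₁ ⊙ e₂` with `⊙` one of `=, ≠, <, ≤`. -/
structure Literal (K : Type u) (X : Type v) : Type (max u v) where
  cmp : Cmp
  lhs : Expr K X
  rhs : Expr K X

namespace Literal

variable {K : Type u} {X : Type v} {Y : Type w}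

/-- The variables occurring in a literal. -/
def vars (l : Literal K X) : Set X := l.lhs.vars ∪ l.rhs.vars

/-- Renaming of variables. -/
def map (f : X → Y) (l : Literal K X) : Literal K Y := ⟨l.cmp, l.lhs.map f, l.rhs.map f⟩

/-- The equality literal `x = y` between two variables. -/
def eqVar (x y : X) : Literal K X := ⟨Cmp.eq, Expr.var x, Expr.var y⟩

end Literal

/-- Constraints `c := e = e | e ≠ e | e < e | e ≤ e | c ∧ c`. -/
inductive Constraint (K : Type u) (X : Type v) : Type (max u v)
  | lit (l : Literal K X)
  | and (c₁ c₂ : Constraint K X)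

namespace Constraint

variable {K : Type u} {X : Type v}

/-- The literals of a constraint. -/
def literals : Constraint K X → Set (Literal K X)
  | lit l => {l}
  | and c₁ c₂ => c₁.literals ∪ c₂.literals

/-- The variables occurring in a constraint. -/
def vars (c : Constraint K X) : Set X := {x | ∃ l ∈ c.literals, x ∈ l.vars}

end Constraint

/-! ### First-order formulas of linear arithmetic -/

/-- Function symbols: the constants, `+` and `-`. -/
inductive LinFunc (K : Type u) : ℕ → Type u
  | const (k : K) : LinFunc K 0
  | add : LinFunc K 2
  | sub : LinFunc K 2

/-- Relation symbols other than equality: `<` and `≤`. -/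
inductive LinRel : ℕ → Type
  | lt : LinRel 2
  | le : LinRel 2

/-- The first-order language of linear arithmetic with constants `K`. -/
def linLang (K : Type u) : FirstOrder.Language.{u, 0} := ⟨LinFunc K, LinRel⟩

instance {K : Type u} [Encodable K] : Encodable (Σ n, (linLang K).Functions n) :=
  Encodable.ofLeftInverse (α := K ⊕ Bool)
    (fun f => match f with
      | ⟨_, LinFunc.const k⟩ => Sum.inl k
      | ⟨_, LinFunc.add⟩ => Sum.inr true
      | ⟨_, LinFunc.sub⟩ => Sum.inr false)
    (fun s => match s with
      | Sum.inl k => ⟨0, LinFunc.const k⟩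
      | Sum.inr true => ⟨2, LinFunc.add⟩
      | Sum.inr false => ⟨2, LinFunc.sub⟩)
    (fun f => by rcases f with ⟨_, _ | _ | _⟩ <;> rfl)

instance {K : Type u} : Encodable (Σ n, (linLang K).Relations n) :=
  Encodable.ofLeftInverse (α := Bool)
    (fun r => match r with
      | ⟨_, LinRel.lt⟩ => true
      | ⟨_, LinRel.le⟩ => false)
    (fun s => match s with
      | true => ⟨2, LinRel.lt⟩
      | false => ⟨2, LinRel.le⟩)
    (fun r => by rcases r with ⟨_, _ | _⟩ <;> rfl)

/-- The standard interpretation in the domain `D`; the constant symbols are the elements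
of a set `S` of elements of `D` and denote themselves. -/
instance linStructure {D : Type u} [Add D] [Sub D] [LT D] [LE D] (S : Set D) :
    (linLang S).Structure D where
  funMap := fun {_} f xs => match f, xs with
    | LinFunc.const k, _ => (k : D)
    | LinFunc.add, xs => xs 0 + xs 1
    | LinFunc.sub, xs => xs 0 - xs 1
  RelMap := fun {_} r xs => match r, xs with
    | LinRel.lt, xs => xs 0 < xs 1
    | LinRel.le, xs => xs 0 ≤ xs 1

/-- Formulas with free variables in `X`. -/
abbrev Formula (K : Type u) (X : Type v) : Type (max u v) := (linLang K).Formula X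

section ToFormula

variable {K : Type u} {X : Type v}

/-- An expression as a term. -/
def Expr.toTerm : Expr K X → (linLang K).Term X
  | var x => Term.var x
  | const k => Term.func (LinFunc.const k : (linLang K).Functions 0) ![]
  | add e₁ e₂ => Term.func (LinFunc.add : (linLang K).Functions 2) ![e₁.toTerm, e₂.toTerm]
  | sub e₁ e₂ => Term.func (LinFunc.sub : (linLang K).Functions 2) ![e₁.toTerm, e₂.toTerm]

/-- A literal as a formula. -/
def Literal.toFormula (l : Literal K X) : Formula K X :=
  match l.cmp with
  | Cmp.eq => l.lhs.toTerm.equal l.rhs.toTerm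
  | Cmp.ne => (l.lhs.toTerm.equal l.rhs.toTerm).not
  | Cmp.lt => Relations.formula₂ (LinRel.lt : (linLang K).Relations 2) l.lhs.toTerm l.rhs.toTerm
  | Cmp.le => Relations.formula₂ (LinRel.le : (linLang K).Relations 2) l.lhs.toTerm l.rhs.toTerm

/-- A constraint as a formula. -/
def Constraint.toFormula : Constraint K X → Formula K X
  | lit l => l.toFormula
  | and c₁ c₂ => c₁.toFormula ⊓ c₂.toFormula

/-- The conjunction `⋀ C` of a finite set of constraints. -/
noncomputable def conj (C : Finset (Constraint K X)) : Formula K X :=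
  BoundedFormula.iInf (fun c : C => c.1.toFormula)

/-- The standard code of a formula as a natural number. -/
def code [Encodable K] [Encodable X] (φ : Formula K X) : ℕ :=
  Encodable.encode (BoundedFormula.encoding.encode
    (⟨0, φ⟩ : Σ n, (linLang K).BoundedFormula X n))

end ToFormula

section Semantics

variable {D : Type u} [Add D] [Sub D] [LT D] [LE D] {S : Set D} {X : Type v}

/-- Logical equivalence over the domain `D`. -/
def Equivalent (φ ψ : Formula S X) : Prop :=
  ∀ α : X → D, φ.Realize α ↔ ψ.Realize α

/-- Satisfiability over the domain `D`. -/
def Satisfiable (φ : Formula S X) : Prop := ∃ α : X → D, φ.Realize α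

end Semantics

/-! ### Data-aware dynamic systems with arithmetic -/

/-- A DDSA with states `B`, actions `A`, variables `V` and constants `K`. In guards, `Sum.inl v`
is the read variable `vʳ` and `Sum.inr v` the write variable `vʷ`. The transition function may be
partial. -/
structure System (K : Type u) (B : Type v) (A : Type w) (V : Type z) where
  init : B
  trans : B → A → Option B
  final : Set B
  init_val : V → K
  guard : A → Constraint K (V ⊕ V)

namespace System

variable {K : Type u} {B : Type v} {A : Type w} {V : Type z}

/-- The variables written by an action. -/
def write (M : System K B A V) (a : A) : Set V := {x | Sum.inr x ∈ (M.guard a).vars}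

/-- The literals of the transition formula
`Δ_a = guard(a) ∧ ⋀_{v ∉ write(a)} vʷ = vʳ`. -/
def transLiterals (M : System K B A V) (a : A) : Set (Literal K (V ⊕ V)) :=
  (M.guard a).literals ∪ {l | ∃ v, v ∉ M.write a ∧ l = Literal.eqVar (Sum.inr v) (Sum.inl v)}

/-- The transition formula `Δ_a = guard(a) ∧ ⋀_{v ∉ write(a)} vʷ = vʳ`. -/
noncomputable def transFormula [Finite V] (M : System K B A V) (a : A) : Formula K (V ⊕ V) :=
  (M.guard a).toFormula ⊓
    BoundedFormula.iInf (fun v : {v : V // v ∉ M.write a} =>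
      (Literal.eqVar (Sum.inr v.1) (Sum.inl v.1) : Literal K (V ⊕ V)).toFormula)

/-- `update(φ, a) = ∃ U. φ(U) ∧ Δ_a(U, V)`. The variables in the right summand are the
quantified copy `U`, those in the left summand are the free variables `V`. -/
noncomputable def update [Finite V] (M : System K B A V) (φ : Formula K V) (a : A) :
    Formula K V :=
  Formula.iExs V ((Formula.relabel Sum.inr φ ⊓ Formula.relabel Sum.swap (M.transFormula a) :
    Formula K (V ⊕ V)))

/-- The conjunction of the initial constraints `v = α₀(v)`. -/
noncomputable def initFormula [Finite V] (M : System K B A V) : Formula K V :=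
  BoundedFormula.iInf (fun v : V =>
    (⟨Cmp.eq, Expr.var v, Expr.const (M.init_val v)⟩ : Literal K V).toFormula)

/-- A symbolic run of length `n`: a transition sequence from the initial state. -/
structure SymbolicRun (M : System K B A V) (n : ℕ) where
  state : Fin (n + 1) → B
  act : Fin n → A
  start : state 0 = M.init
  step : ∀ k : Fin n, M.trans (state k.castSucc) (act k) = some (state k.succ)

namespace SymbolicRun

variable {M : System K B A V}

/-- The symbolic run without its last step. -/
def dropLast {n : ℕ} (σ : M.SymbolicRun (n + 1)) : M.SymbolicRun n where
  state k := σ.state k.castSucc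
  act k := σ.act k.castSucc
  start := σ.start
  step k := σ.step k.castSucc

/-- The history constraint of a symbolic run and a verification constraint sequence. -/
noncomputable def hist [Finite V] : {n : ℕ} → M.SymbolicRun n →
    (Fin (n + 1) → Finset (Constraint K V)) → Formula K V
  | 0, _, C => M.initFormula ⊓ conj (C 0)
  | n + 1, σ, C =>
      M.update (hist σ.dropLast (fun k => C k.castSucc)) (σ.act (Fin.last n)) ⊓
        conj (C (Fin.last (n + 1)))

/-- The instance of a read or write variable in the `k`-th step, which leads from instant `k`
to instant `k + 1`. -/
def inst {n : ℕ} (k : Fin n) : V ⊕ V → V × Fin (n + 1) :=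
  Sum.elim (fun v => (v, k.castSucc)) (fun v => (v, k.succ))

/-- The literals, over the variable instances, of all the formulas
`Δ_{a_k}(V_{k-1}, V_k) ∧ ⋀ C_k (V_k)` with `1 ≤ k ≤ n`. -/
def literals {n : ℕ} (σ : M.SymbolicRun n) (C : Fin (n + 1) → Finset (Constraint K V)) :
    Set (Literal K (V × Fin (n + 1))) :=
  {l | ∃ k : Fin n,
    (∃ l' ∈ M.transLiterals (σ.act k), l = l'.map (inst k)) ∨
    (∃ c ∈ C k.succ, ∃ l' ∈ c.literals, l = l'.map (fun v => (v, k.succ)))}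

/-- The computation graph: two variable instances are adjacent iff they occur in a common
literal. -/
def compGraph {n : ℕ} (σ : M.SymbolicRun n) (C : Fin (n + 1) → Finset (Constraint K V)) :
    SimpleGraph (V × Fin (n + 1)) where
  Adj p q := p ≠ q ∧ ∃ l ∈ σ.literals C, p ∈ l.vars ∧ q ∈ l.vars
  symm := ⟨fun _ _ h => ⟨h.1.symm, h.2.imp fun _ hl => ⟨hl.1, hl.2.2, hl.2.1⟩⟩⟩
  loopless := ⟨fun _ h => h.1 rfl⟩

/-- The smallest equivalence relation that contains all pairs of variable instances related by an
equality literal. -/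
def EqClass {n : ℕ} (σ : M.SymbolicRun n) (C : Fin (n + 1) → Finset (Constraint K V)) :
    V × Fin (n + 1) → V × Fin (n + 1) → Prop :=
  Relation.EqvGen (fun p q => Literal.eqVar p q ∈ σ.literals C)

/-- The span of the equivalence class of a variable instance: the set of affected instants. -/
def span {n : ℕ} (σ : M.SymbolicRun n) (C : Fin (n + 1) → Finset (Constraint K V))
    (p : V × Fin (n + 1)) : Set (Fin (n + 1)) :=
  {j | ∃ v : V, σ.EqClass C p (v, j)}

end SymbolicRun

/-- `(M, CC)` is feedback-free: for every symbolic run and every verification constraint sequence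
over `CC`, each path in the computation graph between two instances of one variable contains a
node whose span covers the spans of both. -/
def FeedbackFree (M : System K B A V) (CC : Finset (Constraint K V)) : Prop :=
  ∀ (n : ℕ) (σ : M.SymbolicRun n) (C : Fin (n + 1) → Finset (Constraint K V)),
    (∀ k, C k ⊆ CC) →
    ∀ (x : V) (i j : Fin (n + 1)) (p : (σ.compGraph C).Walk (x, i) (x, j)), p.IsPath →
      ∃ y ∈ p.support, σ.span C (x, i) ∪ σ.span C (x, j) ⊆ σ.span C y

section Summary

variable {D : Type u} [Add D] [Sub D] [LT D] [LE D] {S : Set D}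

/-- `Φ` is a history set for `(M, CC)`: it contains, up to logical equivalence, every history
constraint paired with the final state of its symbolic run, and nothing else. -/
def IsHistorySet [Finite V] (M : System S B A V) (CC : Finset (Constraint S V))
    (Φ : Set (B × Formula S V)) : Prop :=
  (∀ (n : ℕ) (σ : M.SymbolicRun n) (C : Fin (n + 1) → Finset (Constraint S V)),
    (∀ k, C k ⊆ CC) →
      ∃ φ, (σ.state (Fin.last n), φ) ∈ Φ ∧ Equivalent (σ.hist C) φ) ∧
  (∀ b φ, (b, φ) ∈ Φ →
    ∃ (n : ℕ) (σ : M.SymbolicRun n) (C : Fin (n + 1) → Finset (Constraint S V)),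
      (∀ k, C k ⊆ CC) ∧ σ.state (Fin.last n) = b ∧ Equivalent (σ.hist C) φ)

/-- The formulas that occur in a set of pairs of a state and a formula. -/
abbrev Formulas (Φ : Set (B × Formula S V)) : Type (max u z) :=
  {φ : Formula S V // ∃ b, (b, φ) ∈ Φ}

/-- A relation on the formulas of `Φ` is decidable: some computable function decides it on codes
of formulas. -/
def DecidableOn [Encodable S] [Encodable V] (Φ : Set (B × Formula S V))
    (r : Formulas Φ → Formulas Φ → Prop) : Prop :=
  ∃ f : ℕ → ℕ → Bool, Computable₂ f ∧
    ∀ φ ψ : Formulas Φ, f (code φ.1) (code ψ.1) = true ↔ r φ ψ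

/-- `(Φ, ∼)` is a summary for `(M, CC)`. -/
structure IsSummary [Finite V] [Encodable S] [Encodable V] (M : System S B A V)
    (CC : Finset (Constraint S V)) (Φ : Set (B × Formula S V)) (s : Setoid (Formulas Φ)) :
    Prop where
  historySet : M.IsHistorySet CC Φ
  contains_equiv : ∀ φ ψ : Formulas Φ, Equivalent φ.1 ψ.1 → s φ ψ
  decidable : DecidableOn Φ s
  equisat : ∀ (b : B) (φ ψ : Formulas Φ), (b, φ.1) ∈ Φ → (b, ψ.1) ∈ Φ → s φ ψ →
    (Satisfiable φ.1 ↔ Satisfiable ψ.1)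
  step : ∀ (b : B) (φ ψ : Formulas Φ), (b, φ.1) ∈ Φ → (b, ψ.1) ∈ Φ → s φ ψ →
    ∀ (a : A) (b' : B), M.trans b a = some b' → ∀ C ⊆ CC,
      ∃ φ' ψ' : Formulas Φ, (b', φ'.1) ∈ Φ ∧ (b', ψ'.1) ∈ Φ ∧
        Equivalent (M.update φ.1 a ⊓ conj C) φ'.1 ∧
        Equivalent (M.update ψ.1 a ⊓ conj C) ψ'.1 ∧ s φ' ψ'

/-- `(M, CC)` has finite summary: it admits a summary `(Φ, ∼)` such that `∼` has finitely many
equivalence classes. -/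
def HasFiniteSummary [Finite V] [Encodable S] [Encodable V] (M : System S B A V)
    (CC : Finset (Constraint S V)) : Prop :=
  ∃ (Φ : Set (B × Formula S V)) (s : Setoid (Formulas Φ)),
    M.IsSummary CC Φ s ∧ Finite (Quotient s)

end Summary

end System

end DDSA

/-! A history constraint describes the projection to the last instant of a constraint network: the
nodes are the classes of variable instances under the equality literals, the constraints are
instances of finitely many literals. It suffices to bound the number of these projections
independently of the length of the run; then logical equivalence on a finite history set is a finite
summary.

The bound comes from tree depth. Call a class alive at the instants in its span; at most `Nat.card
V` classes of a network are alive at one instant. Equality literals join only equal or consecutive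
instants, so spans are intervals. In a connected set `W` of classes, feedback freedom, applied to
two instances of `x` whose spans reach the earliest and the latest instant, yields one class in `W`
whose span covers those of all instances of `x` in `W` (`exists_forall_span_subset`). Delete such a
class for each `x`: wherever a remaining class is alive, a deleted one was alive too, so the width
drops by one (`exists_hasWidth`). After at most `Nat.card V` rounds nothing is left.

Each round turns a solution set into "there are values for the deleted nodes that lie in the
solution sets of all remaining components" (`solutions_mem_family`). The number of components is
unbounded, but a conjunction depends only on the set of its conjuncts, so each depth admits finitely
many solution sets (`finite_family`). This counts sets and needs no quantifier elimination. -/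

namespace DDSA

open Relation

/-! ### Constraint networks of bounded tree depth -/

/-- A network over the nodes `Q` is a set of relation symbols from `R` applied to nodes. The
symbol `r` has argument places `supp r ⊆ X` and is interpreted by `rel r`. -/
structure Template (R X D : Type*) where
  supp : R → Set X
  rel : R → Set (X → D)
  congr : ∀ r g g', (∀ x ∈ supp r, g x = g' x) → g ∈ rel r → g' ∈ rel r

namespace Template

variable {R : Type u} {X : Type v} {D : Type w} {Q : Type*} (𝒯 : Template R X D)

/-- The assignments of the parameters `p` that extend to a solution of all the constraints
between nodes in `W` and parameters. -/
def solutions (K : Set (R × (X → Q))) {I : Type*} (p : I → Q) (W : Set Q) : Set (I → D) :=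
  {γ | ∃ β : Q → D, (∀ i, β (p i) = γ i) ∧
    ∀ k ∈ K, (∀ x ∈ 𝒯.supp k.1, k.2 x ∈ W ∪ Set.range p) → (fun x => β (k.2 x)) ∈ 𝒯.rel k.1}

/-- Two nodes occur in a common constraint. -/
def Linked (K : Set (R × (X → Q))) (a b : Q) : Prop :=
  ∃ k ∈ K, ∃ x ∈ 𝒯.supp k.1, ∃ y ∈ 𝒯.supp k.1, k.2 x = a ∧ k.2 y = b

/-- Connectedness by links inside `W`. -/
def Conn (K : Set (R × (X → Q))) (W : Set Q) : Q → Q → Prop :=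
  EqvGen fun a b => a ∈ W ∧ b ∈ W ∧ 𝒯.Linked K a b

variable {𝒯} {K : Set (R × (X → Q))} {W : Set Q}

theorem Conn.mem_iff {a b : Q} (h : 𝒯.Conn K W a b) : a ∈ W ↔ b ∈ W := by
  induction h with
  | rel a b h => simp [h.1, h.2.1]
  | refl => rfl
  | symm _ _ _ ih => exact ih.symm
  | trans _ _ _ _ _ h₁ h₂ => exact h₁.trans h₂

theorem Conn.component {a b c : Q} (h : 𝒯.Conn K W a b) (ha : 𝒯.Conn K W c a) :
    𝒯.Conn K {q | 𝒯.Conn K W c q} a b := by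
  induction h with
  | rel a b h => exact .rel _ _ ⟨ha, ha.trans _ _ _ (.rel _ _ h), h.2.2⟩
  | refl => exact .refl _
  | symm a b h ih => exact (ih (ha.trans _ _ _ (h.symm _ _))).symm _ _
  | trans a b d h₁ h₂ ih₁ ih₂ => exact (ih₁ ha).trans _ _ _ (ih₂ (ha.trans _ _ _ h₁))

theorem solutions_mono {I : Type*} (p : I → Q) {W W' : Set Q} (h : W' ⊆ W) :
    𝒯.solutions K p W ⊆ 𝒯.solutions K p W' := by
  rintro γ ⟨β, hβ, hK⟩
  exact ⟨β, hβ, fun k hk hx => hK k hk fun x hx' => Set.union_subset_union_left _ h (hx x hx')⟩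

/-- A network splits into the connected components of its nodes that are no parameters. -/
theorem mem_solutions_iff [Inhabited D] {I : Type*} (p : I → Q) (W : Set Q) (γ : I → D) :
    γ ∈ 𝒯.solutions K p W ↔ γ ∈ 𝒯.solutions K p ∅ ∧
      ∀ w ∈ W \ Set.range p, γ ∈ 𝒯.solutions K p {q | 𝒯.Conn K (W \ Set.range p) w q} := by
  classical
  constructor
  · refine fun h => ⟨solutions_mono p (Set.empty_subset _) h, fun w hw => solutions_mono p ?_ h⟩
    exact fun q hq => ((Conn.mem_iff hq).1 hw).1
  rintro ⟨⟨β₀, hβ₀, hK₀⟩, hcomp⟩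
  set W' := W \ Set.range p with hW'
  -- Solutions are indexed by the component as a set, so that all nodes of one component take their
  -- values from the same solution.
  have hB : ∀ c : Set Q, ∃ β : Q → D, γ ∈ 𝒯.solutions K p c → (∀ i, β (p i) = γ i) ∧
      ∀ k ∈ K, (∀ x ∈ 𝒯.supp k.1, k.2 x ∈ c ∪ Set.range p) →
        (fun x => β (k.2 x)) ∈ 𝒯.rel k.1 := by
    intro c
    by_cases h : γ ∈ 𝒯.solutions K p c
    · obtain ⟨β, hβ⟩ := h
      exact ⟨β, fun _ => hβ⟩
    · exact ⟨β₀, fun h' => absurd h' h⟩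
  choose B hB using hB
  let β : Q → D := fun q => if q ∈ Set.range p then β₀ q else B {q' | 𝒯.Conn K W' q q'} q
  have hβp : ∀ i, β (p i) = γ i := fun i => by
    simp only [β, Set.mem_range_self, if_true, hβ₀]
  refine ⟨β, hβp, fun k hk hx => ?_⟩
  by_cases hall : ∀ x ∈ 𝒯.supp k.1, k.2 x ∈ Set.range p
  · refine 𝒯.congr _ _ _ ?_ (hK₀ k hk fun x hx' => Or.inr (hall x hx'))
    intro x hx'
    simp only [β, hall x hx', if_true]
  push Not at hall
  obtain ⟨x₀, hx₀, hx₀p⟩ := hall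
  have hx₀W : k.2 x₀ ∈ W' := ⟨(hx x₀ hx₀).resolve_right hx₀p, hx₀p⟩
  obtain ⟨hBp, hBK⟩ := hB _ (hcomp _ hx₀W)
  -- A constraint links all its nodes, so those that are no parameters lie in one component.
  have hconn : ∀ x ∈ 𝒯.supp k.1, k.2 x ∉ Set.range p → 𝒯.Conn K W' (k.2 x₀) (k.2 x) :=
    fun x hx' hp => .rel _ _
      ⟨hx₀W, ⟨(hx x hx').resolve_right hp, hp⟩, k, hk, x₀, hx₀, x, hx', rfl, rfl⟩
  refine 𝒯.congr _ _ _ ?_ (hBK k hk fun x hx' => ?_)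
  · intro x hx'
    by_cases hp : k.2 x ∈ Set.range p
    · obtain ⟨i, hi⟩ := hp
      simp only [← hi, hβp, hBp]
    · simp only [β, hp, if_false]
      have h : {q | 𝒯.Conn K W' (k.2 x₀) q} = {q | 𝒯.Conn K W' (k.2 x) q} := by
        ext q
        exact ⟨fun h => ((hconn x hx' hp).symm _ _).trans _ _ _ h,
          fun h => (hconn x hx' hp).trans _ _ _ h⟩
      rw [h]
  · by_cases hp : k.2 x ∈ Set.range p
    · exact Or.inr hp
    · exact Or.inl (hconn x hx' hp)

/-- Promoting nodes of `W` to parameters does not change which constraints are imposed; it only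
names their values. -/
theorem mem_solutions_iff_exists {I V : Type*} (p : I → Q) {y : V → Q} (hy : ∀ x, y x ∈ W)
    (γ : I → D) :
    γ ∈ 𝒯.solutions K p W ↔ ∃ δ : V → D, Sum.elim γ δ ∈ 𝒯.solutions K (Sum.elim p y) W := by
  have h : W ∪ Set.range (Sum.elim p y) = W ∪ Set.range p := by
    rw [Set.Sum.elim_range, ← Set.union_assoc, Set.union_right_comm,
      Set.union_eq_self_of_subset_right (Set.range_subset_iff.2 hy)]
  simp only [solutions, Set.mem_ofPred_eq, h]
  constructor
  · rintro ⟨β, hβ, hK⟩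
    exact ⟨fun x => β (y x), β, by rintro (i | x) <;> simp [hβ], hK⟩
  · rintro ⟨δ, β, hβ, hK⟩
    exact ⟨β, fun i => hβ (Sum.inl i), hK⟩

variable (𝒯) in
/-- Finite families of sets that contain the solution sets of all the networks of tree depth at
most `d`. -/
def family [Inhabited D] (V : Type z) : ℕ → (I : Type z) → Set (Set (I → D))
  -- `none` marks argument places outside the support, whose value is immaterial. The pairs in `t.2`
  -- record parameters placed at the same node.
  | 0, I => Set.range fun t : Set (R × (X → Option I)) × Set (I × I) =>
      {γ | (∀ e ∈ t.2, γ e.1 = γ e.2) ∧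
        ∀ k ∈ t.1, (fun x => (k.2 x).elim default γ) ∈ 𝒯.rel k.1}
  -- The left summand serves networks with no node left to delete. On the right, `δ` gives the
  -- values at deleted nodes and `T` is a set, so repeated components count once.
  | d + 1, I => family V 0 I ∪
      (fun T : Set (Set (I ⊕ V → D)) => {γ | ∃ δ : V → D, ∀ s ∈ T, Sum.elim γ δ ∈ s}) ''
        𝒫 (family V d (I ⊕ V))

theorem finite_family [Inhabited D] [Finite R] [Finite X] (V : Type z) [Finite V] (d : ℕ) :
    ∀ (I : Type z) [Finite I], (𝒯.family V d I).Finite := by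
  induction d with
  | zero => intro I _; rw [family]; exact Set.finite_range _
  | succ d ih =>
    intro I _
    rw [family]
    refine Set.Finite.union ?_ ((ih (I ⊕ V)).finite_subsets.image _)
    rw [family]; exact Set.finite_range _

theorem solutions_empty_mem_family [Inhabited D] (V : Type z) (d : ℕ) (I : Type z) (p : I → Q) :
    𝒯.solutions K p ∅ ∈ 𝒯.family V d I := by
  classical
  have h : 𝒯.solutions K p ∅ ∈ 𝒯.family V 0 I := by
    rw [family]
    refine ⟨({k | ∃ f, (k.1, f) ∈ K ∧ ∀ x ∈ 𝒯.supp k.1, ∃ i, k.2 x = some i ∧ p i = f x},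
      {e | p e.1 = p e.2}), ?_⟩
    ext γ
    constructor
    · rintro ⟨hE, hT⟩
      let β : Q → D := fun q => if h : ∃ i, p i = q then γ h.choose else default
      have hβ : ∀ i, β (p i) = γ i := fun i => by
        have h : ∃ j, p j = p i := ⟨i, rfl⟩
        simp only [β, dif_pos h]
        exact hE (h.choose, i) h.choose_spec
      refine ⟨β, hβ, fun k hk hx => ?_⟩
      let g : X → Option I := fun x => if h : ∃ i, p i = k.2 x then some h.choose else none
      have hg : ∀ x ∈ 𝒯.supp k.1, ∃ i, g x = some i ∧ p i = k.2 x := fun x hx' => by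
        have h : ∃ i, p i = k.2 x := by simpa using hx x hx'
        exact ⟨h.choose, dif_pos h, h.choose_spec⟩
      refine 𝒯.congr _ _ _ (fun x hx' => ?_) (hT (k.1, g) ⟨k.2, hk, hg⟩)
      obtain ⟨i, hi, hi'⟩ := hg x hx'
      simp only [hi, ← hi', hβ, Option.elim]
    · rintro ⟨β, hβ, hK⟩
      refine ⟨fun e he => ?_, ?_⟩
      · rw [← hβ, ← hβ]
        exact congrArg β he
      · rintro k ⟨f, hf, hx⟩
        refine 𝒯.congr _ _ _ (fun x hx' => ?_) (hK (k.1, f) hf fun x hx' => ?_)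
        · obtain ⟨i, hi, hi'⟩ := hx x hx'
          simp only [hi, ← hi', hβ, Option.elim]
        · obtain ⟨i, hi, hi'⟩ := hx x hx'
          exact Or.inr ⟨i, hi'⟩
  cases d with
  | zero => exact h
  | succ d => rw [family]; exact Or.inl h

/-- If every connected set of nodes contains, for some measure of width, boundedly many nodes
whose removal decreases the width, then the solution sets of connected sets of nodes of width `d`
belong to the `d`-th family. -/
theorem solutions_mem_family [Inhabited D] {V : Type z} (width : Set Q → ℕ → Prop)
    (width_zero : ∀ W, width W 0 → W = ∅)
    (width_succ : ∀ (W : Set Q) (d : ℕ), W.Nonempty → (∀ a ∈ W, ∀ b ∈ W, 𝒯.Conn K W a b) →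
      width W (d + 1) → ∃ y : V → Q, (∀ x, y x ∈ W) ∧ ∀ c ⊆ W \ Set.range y, width c d)
    (d : ℕ) : ∀ (I : Type z) (p : I → Q) (W : Set Q), (∀ a ∈ W, ∀ b ∈ W, 𝒯.Conn K W a b) →
      width W d → 𝒯.solutions K p W ∈ 𝒯.family V d I := by
  induction d with
  | zero =>
    intro I p W _ hw
    rw [width_zero W hw]
    exact solutions_empty_mem_family V 0 I p
  | succ d ih =>
    intro I p W hconn hw
    rcases W.eq_empty_or_nonempty with rfl | hne
    · exact solutions_empty_mem_family V _ I p
    obtain ⟨y, hy, hc⟩ := width_succ W d hne hconn hw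
    rw [family]
    set p' : I ⊕ V → Q := Sum.elim p y
    set W' := W \ Set.range p'
    -- The conjuncts are the constraints among parameters and, for each component left after
    -- deleting `y`, its solution set.
    refine Or.inr ⟨insert (𝒯.solutions K p' ∅)
      ((fun w => 𝒯.solutions K p' {q | 𝒯.Conn K W' w q}) '' W'), ?_, ?_⟩
    · rw [Set.mem_powerset_iff, Set.insert_subset_iff, Set.image_subset_iff]
      refine ⟨solutions_empty_mem_family V d _ p', fun w hw' => ih _ _ _ ?_ (hc _ ?_)⟩
      · intro a ha b hb
        exact Conn.component ((EqvGen.symm _ _ ha).trans _ _ _ hb) ha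
      · intro q hq
        have hq' : q ∈ W' := (Conn.mem_iff hq).1 hw'
        exact ⟨hq'.1, fun ⟨x, hx⟩ => hq'.2 ⟨Sum.inr x, hx⟩⟩
    · ext γ
      rw [mem_solutions_iff_exists p hy]
      refine exists_congr fun δ => ?_
      rw [mem_solutions_iff p' W, Set.forall_mem_insert, Set.forall_mem_image]

/-- The whole network need not be connected, hence an intersection of members of the family in place
of a single member. -/
theorem solutions_univ_mem [Inhabited D] {V : Type z} (width : Set Q → ℕ → Prop)
    (width_zero : ∀ W, width W 0 → W = ∅)
    (width_succ : ∀ (W : Set Q) (d : ℕ), W.Nonempty → (∀ a ∈ W, ∀ b ∈ W, 𝒯.Conn K W a b) →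
      width W (d + 1) → ∃ y : V → Q, (∀ x, y x ∈ W) ∧ ∀ c ⊆ W \ Set.range y, width c d)
    {d : ℕ} (hd : ∀ W, width W d) (I : Type z) (p : I → Q) :
    𝒯.solutions K p Set.univ ∈ Set.sInter '' 𝒫 (𝒯.family V d I) := by
  set W' := Set.univ \ Set.range p
  refine ⟨insert (𝒯.solutions K p ∅)
      ((fun w => 𝒯.solutions K p {q | 𝒯.Conn K W' w q}) '' W'), ?_, ?_⟩
  · rw [Set.mem_powerset_iff, Set.insert_subset_iff, Set.image_subset_iff]
    refine ⟨solutions_empty_mem_family V d _ p, fun w hw' =>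
      solutions_mem_family width width_zero width_succ d _ _ _ ?_ (hd _)⟩
    intro a ha b hb
    exact Conn.component ((EqvGen.symm _ _ ha).trans _ _ _ hb) ha
  · ext γ
    rw [Set.mem_sInter, mem_solutions_iff p Set.univ, Set.forall_mem_insert,
      Set.forall_mem_image]

end Template

end DDSA

namespace DDSA

open FirstOrder FirstOrder.Language

/-! ### Semantics of literals, constraints and history constraints -/

section Semantics

variable {D : Type u} [Add D] [Sub D] {S : Set D} {X : Type v}

/-- The value of an expression. -/
def Expr.eval (g : X → D) : Expr S X → D
  | var x => g x
  | const k => k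
  | add e₁ e₂ => e₁.eval g + e₂.eval g
  | sub e₁ e₂ => e₁.eval g - e₂.eval g

theorem Expr.eval_congr {g g' : X → D} {e : Expr S X} (h : ∀ x ∈ e.vars, g x = g' x) :
    e.eval g = e.eval g' := by
  induction e with
  | var x => exact h x rfl
  | const k => rfl
  | add e₁ e₂ h₁ h₂ =>
    exact congrArg₂ (· + ·) (h₁ fun x hx => h x (Or.inl hx)) (h₂ fun x hx => h x (Or.inr hx))
  | sub e₁ e₂ h₁ h₂ =>
    exact congrArg₂ (· - ·) (h₁ fun x hx => h x (Or.inl hx)) (h₂ fun x hx => h x (Or.inr hx))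

variable [LT D] [LE D]

@[simp]
theorem Expr.realize_toTerm (g : X → D) (e : Expr S X) : e.toTerm.realize g = e.eval g := by
  induction e with
  | var x => rfl
  | const k => rfl
  | add e₁ e₂ h₁ h₂ => exact congrArg₂ (· + ·) h₁ h₂
  | sub e₁ e₂ h₁ h₂ => exact congrArg₂ (· - ·) h₁ h₂

/-- Truth of a literal. -/
def Literal.Holds (g : X → D) (l : Literal S X) : Prop :=
  match l.cmp with
  | Cmp.eq => l.lhs.eval g = l.rhs.eval g
  | Cmp.ne => l.lhs.eval g ≠ l.rhs.eval g
  | Cmp.lt => l.lhs.eval g < l.rhs.eval g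
  | Cmp.le => l.lhs.eval g ≤ l.rhs.eval g

@[simp]
theorem Literal.realize_toFormula (g : X → D) (l : Literal S X) :
    l.toFormula.Realize g ↔ l.Holds g := by
  rcases l with ⟨_ | _ | _ | _, e₁, e₂⟩
  · simp [toFormula, Holds]
  · simp [toFormula, Holds]
  · refine (Formula.realize_rel₂ (L := linLang S) (R := LinRel.lt)).trans ?_
    simp only [Expr.realize_toTerm]
    rfl
  · refine (Formula.realize_rel₂ (L := linLang S) (R := LinRel.le)).trans ?_
    simp only [Expr.realize_toTerm]
    rfl

theorem Literal.Holds.congr {g g' : X → D} {l : Literal S X} (h : ∀ x ∈ l.vars, g x = g' x)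
    (hl : l.Holds g) : l.Holds g' := by
  have h₁ := Expr.eval_congr fun x hx => h x (Or.inl hx)
  have h₂ := Expr.eval_congr fun x hx => h x (Or.inr hx)
  rwa [Holds, ← h₁, ← h₂]

@[simp]
theorem Constraint.realize_toFormula (g : X → D) (c : Constraint S X) :
    c.toFormula.Realize g ↔ ∀ l ∈ c.literals, l.Holds g := by
  induction c with
  | lit l => simp [toFormula, literals]
  | and c₁ c₂ h₁ h₂ => simp [toFormula, literals, h₁, h₂, or_imp, forall_and]

theorem realize_iInf {ι : Type*} [Finite ι] (f : ι → Formula S X) (g : X → D) :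
    Formula.Realize (BoundedFormula.iInf f) g ↔ ∀ i, (f i).Realize g :=
  BoundedFormula.realize_iInf

@[simp]
theorem realize_conj (g : X → D) (C : Finset (Constraint S X)) :
    (conj C).Realize g ↔ ∀ c ∈ C, ∀ l ∈ c.literals, l.Holds g := by
  rw [conj, realize_iInf]
  simp

namespace System

variable {B A V : Type*} [Finite V] {M : System S B A V}

theorem realize_transFormula (a : A) (g : V ⊕ V → D) :
    (M.transFormula a).Realize g ↔ ∀ l ∈ M.transLiterals a, l.Holds g := by
  rw [transFormula, Formula.realize_inf, realize_iInf]
  simp only [Constraint.realize_toFormula, Literal.realize_toFormula, transLiterals,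
    Set.mem_union, or_imp, forall_and, Subtype.forall]
  refine and_congr_right fun _ => ⟨?_, fun h v hv => h _ ⟨v, hv, rfl⟩⟩
  rintro h _ ⟨v, hv, rfl⟩
  exact h v hv

theorem realize_update (φ : Formula S V) (a : A) (g : V → D) :
    (M.update φ a).Realize g ↔
      ∃ u, φ.Realize u ∧ ∀ l ∈ M.transLiterals a, l.Holds (Sum.elim u g) := by
  rw [update, Formula.realize_iExs]
  refine exists_congr fun u => ?_
  rw [Formula.realize_inf, Formula.realize_relabel, Formula.realize_relabel,
    realize_transFormula, Sum.elim_comp_inr, Sum.elim_swap]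

theorem realize_initFormula (g : V → D) : M.initFormula.Realize g ↔ ∀ v, g v = M.init_val v := by
  rw [initFormula, realize_iInf]
  simp [Literal.Holds, Expr.eval]

theorem update_inf_conj_equivalent {φ ψ : Formula S V} (h : Equivalent φ ψ) (a : A)
    (C : Finset (Constraint S V)) :
    Equivalent (M.update φ a ⊓ conj C) (M.update ψ a ⊓ conj C) := by
  intro g
  have h' : ∀ u, φ.Realize u ↔ ψ.Realize u := h
  simp only [Formula.realize_inf, realize_update, h']

/-- The data along a run: valuations that start with the initial one and satisfy all
transition formulas and verification constraints. -/
theorem SymbolicRun.realize_hist {n : ℕ} (σ : M.SymbolicRun n)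
    (C : Fin (n + 1) → Finset (Constraint S V)) (g : V → D) :
    (σ.hist C).Realize g ↔ ∃ β : Fin (n + 1) → V → D, β (Fin.last n) = g ∧
      (∀ v, β 0 v = M.init_val v) ∧ (∀ k, ∀ c ∈ C k, ∀ l ∈ c.literals, l.Holds (β k)) ∧
      ∀ k : Fin n, ∀ l ∈ M.transLiterals (σ.act k),
        l.Holds (Sum.elim (β k.castSucc) (β k.succ)) := by
  induction n generalizing g with
  | zero =>
    rw [hist, Formula.realize_inf, realize_initFormula, realize_conj]
    constructor
    · rintro ⟨h₁, h₂⟩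
      refine ⟨fun _ => g, rfl, h₁, fun k => ?_, fun k => k.elim0⟩
      rw [Fin.fin_one_eq_zero k]
      exact h₂
    · rintro ⟨β, rfl, h₁, h₂, -⟩
      exact ⟨h₁, h₂ 0⟩
  | succ n ih =>
    rw [hist, Formula.realize_inf, realize_update, realize_conj]
    simp only [ih]
    constructor
    · rintro ⟨⟨_, ⟨β, rfl, h₁, h₂, h₃⟩, h₄⟩, h₅⟩
      refine ⟨Fin.snoc (α := fun _ => V → D) β g, ?_, ?_, ?_, ?_⟩
      · exact Fin.snoc_last _ _
      · rw [← Fin.castSucc_zero, Fin.snoc_castSucc]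
        exact h₁
      · intro k
        refine Fin.lastCases ?_ (fun k => ?_) k
        · rw [Fin.snoc_last]
          exact h₅
        · rw [Fin.snoc_castSucc]
          exact h₂ k
      · intro k
        refine Fin.lastCases ?_ (fun k => ?_) k
        · rw [Fin.succ_last, Fin.snoc_last, Fin.snoc_castSucc]
          exact h₄
        · rw [Fin.succ_castSucc, Fin.snoc_castSucc, Fin.snoc_castSucc]
          exact h₃ k
    · rintro ⟨β, rfl, h₁, h₂, h₃⟩
      refine ⟨⟨_, ⟨fun k => β k.castSucc, rfl, h₁, fun k => h₂ _, fun k => ?_⟩,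
        h₃ (Fin.last n)⟩, h₂ _⟩
      exact h₃ k.castSucc

end System

end Semantics

/-! ### Renaming of literals and finiteness of sets of literals. -/

section Finiteness

variable {K : Type u} {X : Type v} {Y : Type w}

theorem Expr.vars_map (f : X → Y) (e : Expr K X) : (e.map f).vars = f '' e.vars := by
  induction e <;> simp_all [Expr.map, Expr.vars, Set.image_union]

theorem Literal.vars_map (f : X → Y) (l : Literal K X) : (l.map f).vars = f '' l.vars := by
  simp [Literal.map, Literal.vars, Expr.vars_map, Set.image_union]

theorem Constraint.finite_literals (c : Constraint K X) : c.literals.Finite := by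
  induction c with
  | lit l => exact Set.finite_singleton l
  | and c₁ c₂ h₁ h₂ => exact h₁.union h₂

theorem System.finite_transLiterals {B A V : Type*} [Finite V] (M : System K B A V) (a : A) :
    (M.transLiterals a).Finite := by
  refine (Constraint.finite_literals _).union
    ((Set.finite_range fun v => Literal.eqVar (Sum.inr v) (Sum.inl v)).subset ?_)
  rintro _ ⟨v, -, rfl⟩
  exact ⟨v, rfl⟩

theorem Literal.map_eq_eqVar {f : X → Y} {l : Literal K X} {p q : Y}
    (h : l.map f = Literal.eqVar p q) : ∃ x y, l = Literal.eqVar x y ∧ f x = p ∧ f y = q := by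
  rcases l with ⟨c, e₁, e₂⟩
  simp only [Literal.map, Literal.eqVar, Literal.mk.injEq] at h
  obtain ⟨rfl, h₁, h₂⟩ := h
  cases e₁ <;> simp only [Expr.map, Expr.var.injEq, reduceCtorEq] at h₁
  cases e₂ <;> simp only [Expr.map, Expr.var.injEq, reduceCtorEq] at h₂
  exact ⟨_, _, rfl, h₁, h₂⟩

end Finiteness

end DDSA

namespace DDSA

open Relation

/-! ### Composition of renamings and truth under renaming. -/

section Map

theorem Expr.map_map {K : Type u} {X Y Z : Type*} (f : X → Y) (g : Y → Z) (e : Expr K X) :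
    (e.map f).map g = e.map (g ∘ f) := by
  induction e <;> simp_all [Expr.map]

theorem Literal.map_map {K : Type u} {X Y Z : Type*} (f : X → Y) (g : Y → Z) (l : Literal K X) :
    (l.map f).map g = l.map (g ∘ f) := by
  simp [Literal.map, Expr.map_map]

theorem Expr.eval_map {D : Type u} [Add D] [Sub D] {S : Set D} {X Y : Type*} (f : X → Y)
    (g : Y → D) (e : Expr S X) : (e.map f).eval g = e.eval (g ∘ f) := by
  induction e <;> simp_all [Expr.map, Expr.eval]

theorem Literal.holds_map {D : Type u} [Add D] [Sub D] [LT D] [LE D] {S : Set D} {X Y : Type*}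
    (f : X → Y) (g : Y → D) (l : Literal S X) : (l.map f).Holds g ↔ l.Holds (g ∘ f) := by
  simp [Literal.map, Literal.Holds, Expr.eval_map]

end Map

namespace System

/-! ### The finitely many literals that all runs instantiate. -/

section TemplateLiterals

variable {K : Type u} {B A V : Type*}

/-- The literal `vʳ = α₀(v)`. -/
def initLiteral (M : System K B A V) (v : V) : Literal K (V ⊕ V) :=
  ⟨Cmp.eq, Expr.var (Sum.inl v), Expr.const (M.init_val v)⟩

/-- The literals that occur, up to instantiation, in history constraints. -/
def templateLiterals (M : System K B A V) (CC : Finset (Constraint K V)) :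
    Set (Literal K (V ⊕ V)) :=
  (⋃ a, M.transLiterals a) ∪ (⋃ c ∈ CC, Literal.map Sum.inr '' c.literals) ∪
    Set.range M.initLiteral

theorem finite_templateLiterals [Finite A] [Finite V] (M : System K B A V)
    (CC : Finset (Constraint K V)) : (M.templateLiterals CC).Finite :=
  ((Set.finite_iUnion M.finite_transLiterals).union
    (CC.finite_toSet.biUnion fun c _ => c.finite_literals.image _)).union (Set.finite_range _)

end TemplateLiterals

namespace SymbolicRun

/-! ### Equivalence classes of variable instances -/

section Classes

variable {K : Type u} {B A V : Type*} {M : System K B A V} {n : ℕ} (σ : M.SymbolicRun n)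
  (C : Fin (n + 1) → Finset (Constraint K V))

/-- Equality of variable instances enforced by equality literals. -/
def classSetoid : Setoid (V × Fin (n + 1)) :=
  EqvGen.setoid fun p q => Literal.eqVar p q ∈ σ.literals C

/-- The equivalence classes of variable instances. -/
abbrev Classes : Type _ := Quotient (σ.classSetoid C)

/-- The class of a variable instance. -/
def toClass (p : V × Fin (n + 1)) : σ.Classes C := Quotient.mk _ p

/-- The instants of the members of a class. -/
def classSpan (q : σ.Classes C) : Set (Fin (n + 1)) := {t | ∃ v, σ.toClass C (v, t) = q}

variable {σ C}

theorem toClass_eq_iff {p q : V × Fin (n + 1)} :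
    σ.toClass C p = σ.toClass C q ↔ σ.EqClass C p q :=
  Quotient.eq (r := σ.classSetoid C)

theorem exists_toClass (q : σ.Classes C) : ∃ v t, σ.toClass C (v, t) = q := by
  obtain ⟨p, hp⟩ := Quotient.exists_rep q
  exact ⟨p.1, p.2, hp⟩

theorem span_eq_classSpan (p : V × Fin (n + 1)) :
    σ.span C p = σ.classSpan C (σ.toClass C p) := by
  ext t
  exact exists_congr fun v => toClass_eq_iff.symm.trans eq_comm

theorem eqVar_mem_literals {p q : V × Fin (n + 1)} (h : Literal.eqVar p q ∈ σ.literals C) :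
    ∃ k : Fin n, (p.2 = k.castSucc ∨ p.2 = k.succ) ∧ (q.2 = k.castSucc ∨ q.2 = k.succ) := by
  obtain ⟨k, ⟨l, -, hl⟩ | ⟨c, -, l, -, hl⟩⟩ := h
  · obtain ⟨x, y, -, rfl, rfl⟩ := Literal.map_eq_eqVar hl.symm
    exact ⟨k, by cases x <;> simp [inst], by cases y <;> simp [inst]⟩
  · obtain ⟨x, y, -, rfl, rfl⟩ := Literal.map_eq_eqVar hl.symm
    exact ⟨k, by simp⟩

/-- An equality literal joins instances at equal or consecutive instants, so a chain of equalities
cannot skip an instant. -/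
theorem EqClass.exists_of_mem_uIcc {p q : V × Fin (n + 1)} (h : σ.EqClass C p q)
    {t : Fin (n + 1)} (ht : t ∈ Set.uIcc p.2 q.2) : ∃ v, σ.EqClass C p (v, t) := by
  induction h with
  | rel p q h =>
    have ht' : t = p.2 ∨ t = q.2 := by
      obtain ⟨k, hp, hq⟩ := eqVar_mem_literals h
      rw [Set.mem_uIcc] at ht
      simp only [Fin.ext_iff, Fin.le_def, Fin.val_castSucc, Fin.val_succ] at *
      omega
    rcases ht' with rfl | rfl
    · exact ⟨p.1, .refl _⟩
    · exact ⟨q.1, .rel _ _ h⟩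
  | refl p =>
    rw [Set.uIcc_self, Set.mem_singleton_iff] at ht
    subst ht
    exact ⟨p.1, .refl _⟩
  | symm p q h ih =>
    obtain ⟨v, hv⟩ := ih (by rwa [Set.uIcc_comm])
    exact ⟨v, (h.symm _ _).trans _ _ _ hv⟩
  | trans p q r h₁ h₂ ih₁ ih₂ =>
    rcases Set.uIcc_subset_uIcc_union_uIcc (b := q.2) ht with ht | ht
    · exact ih₁ ht
    · obtain ⟨v, hv⟩ := ih₂ ht
      exact ⟨v, h₁.trans _ _ _ hv⟩

theorem ordConnected_classSpan (q : σ.Classes C) : (σ.classSpan C q).OrdConnected := by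
  refine ⟨?_⟩
  rintro s ⟨u, rfl⟩ t ⟨v, hv⟩ r hr
  obtain ⟨w, hw⟩ := EqClass.exists_of_mem_uIcc (toClass_eq_iff.1 hv.symm)
    (Set.Icc_subset_uIcc hr)
  exact ⟨w, toClass_eq_iff.2 (hw.symm _ _)⟩

variable (σ C) in
/-- Two variable instances are joined by a walk in the computation graph all of whose nodes have
their classes in `W`. -/
def Joined (W : Set (σ.Classes C)) (a b : V × Fin (n + 1)) : Prop :=
  ∃ p : (σ.compGraph C).Walk a b, ∀ z ∈ p.support, σ.toClass C z ∈ W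

theorem Joined.symm {W : Set (σ.Classes C)} {a b : V × Fin (n + 1)} :
    σ.Joined C W a b → σ.Joined C W b a := by
  rintro ⟨p, hp⟩
  exact ⟨p.reverse, by simpa using hp⟩

theorem Joined.trans {W : Set (σ.Classes C)} {a b c : V × Fin (n + 1)} :
    σ.Joined C W a b → σ.Joined C W b c → σ.Joined C W a c := by
  rintro ⟨p, hp⟩ ⟨p', hp'⟩
  refine ⟨p.append p', fun z hz => ?_⟩
  rw [SimpleGraph.Walk.mem_support_append_iff] at hz
  exact hz.elim (hp z) (hp' z)

theorem Joined.of_literal {W : Set (σ.Classes C)} {a b : V × Fin (n + 1)}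
    (ha : σ.toClass C a ∈ W) (hb : σ.toClass C b ∈ W) {l : Literal K (V × Fin (n + 1))}
    (hl : l ∈ σ.literals C) (hal : a ∈ l.vars) (hbl : b ∈ l.vars) : σ.Joined C W a b := by
  by_cases hab : a = b
  · subst hab
    exact ⟨.nil, by simpa using ha⟩
  · refine ⟨.cons (show (σ.compGraph C).Adj a b from ⟨hab, l, hl, hal, hbl⟩) .nil, fun z hz => ?_⟩
    rw [SimpleGraph.Walk.support_cons, SimpleGraph.Walk.support_nil, List.mem_cons,
      List.mem_singleton] at hz
    rcases hz with rfl | rfl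
    · exact ha
    · exact hb

/-- Equality literals are themselves edges of the computation graph, so each class is connected
without leaving it. -/
theorem Joined.of_eqClass {W : Set (σ.Classes C)} {a b : V × Fin (n + 1)}
    (h : σ.EqClass C a b) : σ.toClass C a ∈ W → σ.Joined C W a b := by
  induction h with
  | rel a b h =>
    intro ha
    have hb : σ.toClass C b = σ.toClass C a := toClass_eq_iff.2 (.symm _ _ (.rel _ _ h))
    exact .of_literal ha (hb ▸ ha) h (Or.inl rfl) (Or.inr rfl)
  | refl a => exact fun ha => ⟨.nil, by simpa using ha⟩
  | symm a b h ih =>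
    intro hb
    have hab : σ.toClass C a = σ.toClass C b := toClass_eq_iff.2 h
    exact (ih (hab ▸ hb)).symm
  | trans a b c h₁ h₂ ih₁ ih₂ =>
    intro ha
    have hab : σ.toClass C a = σ.toClass C b := toClass_eq_iff.2 h₁
    exact (ih₁ ha).trans (ih₂ (hab ▸ ha))

variable (σ C) in
/-- At each instant, at most `d` classes of `W` are alive. -/
def HasWidth (W : Set (σ.Classes C)) (d : ℕ) : Prop :=
  ∀ t, {q ∈ W | t ∈ σ.classSpan C q}.ncard ≤ d

/-- A class alive at `t` is the class of one of the `Nat.card V` instances at `t`. -/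
theorem hasWidth_card [Finite V] (W : Set (σ.Classes C)) : σ.HasWidth C W (Nat.card V) := by
  intro t
  rw [← Set.ncard_univ]
  refine (Set.ncard_le_ncard (t := (fun v => σ.toClass C (v, t)) '' Set.univ) ?_
    (Set.toFinite _)).trans (Set.ncard_image_le (Set.toFinite _))
  rintro q ⟨-, v, hv⟩
  exact ⟨v, trivial, hv⟩

theorem eq_empty_of_hasWidth_zero [Finite V] {W : Set (σ.Classes C)} (h : σ.HasWidth C W 0) :
    W = ∅ := by
  refine Set.eq_empty_of_forall_notMem fun q hq => ?_
  obtain ⟨v, t, hvt⟩ := exists_toClass q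
  have h0 := (Set.ncard_eq_zero (Set.toFinite _)).1 (Nat.le_zero.1 (h t))
  exact Set.eq_empty_iff_forall_notMem.1 h0 q ⟨hq, v, hvt⟩

end Classes

/-! ### The network of a run -/

section Network

variable {D : Type u} [Add D] [Sub D] [LT D] [LE D] {S : Set D} {B A V : Type*}

/-- The template of the networks of runs. -/
def _root_.DDSA.System.template (M : System S B A V) (CC : Finset (Constraint S V)) :
    Template (M.templateLiterals CC) (V ⊕ V) D where
  supp r := r.1.vars
  rel r := {g | r.1.Holds g}
  congr _ _ _ h hg := Literal.Holds.congr h hg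

variable {M : System S B A V} {n : ℕ} (σ : M.SymbolicRun n)
  (C : Fin (n + 1) → Finset (Constraint S V)) (CC : Finset (Constraint S V))

/-- The network of a run over the classes of variable instances. -/
def network : Set (M.templateLiterals CC × (V ⊕ V → σ.Classes C)) :=
  {r | (∃ k : Fin n, r.2 = σ.toClass C ∘ inst k ∧ (r.1.1 ∈ M.transLiterals (σ.act k) ∨
      ∃ c ∈ C k.succ, ∃ l ∈ c.literals, r.1.1 = l.map Sum.inr)) ∨
    ∃ v, r.1.1 = M.initLiteral v ∧ r.2 = fun x => σ.toClass C (x.elim id id, 0)}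

variable {σ C CC}

/-- Feedback freedom speaks of walks between instances, the network of links between classes; this
lifts the latter to the former. -/
theorem Joined.of_conn {W : Set (σ.Classes C)} {q q' : σ.Classes C}
    (h : (M.template CC).Conn (σ.network C CC) W q q') :
    ∀ a b, σ.toClass C a = q → σ.toClass C b = q' → q ∈ W → σ.Joined C W a b := by
  induction h with
  | rel q q' h =>
    rintro a b rfl rfl -
    obtain ⟨ha, hb, ⟨⟨l, hl⟩, f⟩, hr, x, hx, y, hy, hax, hby⟩ := h
    change f x = _ at hax
    change f y = _ at hby
    change x ∈ l.vars at hx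
    change y ∈ l.vars at hy
    rcases hr with ⟨k, hf, hk⟩ | ⟨v, hv, hf⟩
    · change f = _ at hf
      subst hf
      have hmem : l.map (inst k) ∈ σ.literals C := by
        refine ⟨k, hk.imp (fun h => ⟨l, h, rfl⟩) ?_⟩
        rintro ⟨c, hc, l', hl', rfl : l = _⟩
        exact ⟨c, hc, l', hl', Literal.map_map _ _ _⟩
      change σ.toClass C (inst k x) = _ at hax
      change σ.toClass C (inst k y) = _ at hby
      have hx' : σ.toClass C (inst k x) ∈ W := hax ▸ ha
      have hy' : σ.toClass C (inst k y) ∈ W := hby ▸ hb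
      -- Move inside the class of `a` to an instance in the literal, cross the edge given by the
      -- literal, then move inside the class of `b`.
      refine (Joined.of_eqClass (toClass_eq_iff.1 hax.symm) ha).trans
        (.trans (.of_literal hx' hy' hmem ?_ ?_)
          (Joined.of_eqClass (toClass_eq_iff.1 hby) hy'))
      · rw [Literal.vars_map]
        exact ⟨x, hx, rfl⟩
      · rw [Literal.vars_map]
        exact ⟨y, hy, rfl⟩
    · change l = _ at hv
      subst hv
      -- Initial literals are no edges of the computation graph, but they mention a single variable
      -- and so link a class only to itself.
      have h : ∀ z ∈ (M.initLiteral v).vars, z = Sum.inl v := by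
        simp [initLiteral, Literal.vars, Expr.vars]
      rw [h x hx] at hax
      rw [h y hy] at hby
      exact Joined.of_eqClass (toClass_eq_iff.1 (hax.symm.trans hby)) ha
  | refl q =>
    rintro a b rfl hb hq
    exact Joined.of_eqClass (toClass_eq_iff.1 hb.symm) hq
  | symm q q' h ih => exact fun a b ha hb hq => (ih b a hb ha ((Template.Conn.mem_iff h).2 hq)).symm
  | trans q q' q'' h₁ h₂ ih₁ ih₂ =>
    intro a b ha hb hq
    obtain ⟨v, t, hvt⟩ := exists_toClass q'
    exact (ih₁ a _ ha hvt hq).trans (ih₂ _ b hvt hb ((Template.Conn.mem_iff h₁).1 hq))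

theorem exists_span_subset (hff : M.FeedbackFree CC) (hC : ∀ k, C k ⊆ CC)
    {W : Set (σ.Classes C)} {x : V} {i j : Fin (n + 1)}
    (hconn : (M.template CC).Conn (σ.network C CC) W (σ.toClass C (x, i)) (σ.toClass C (x, j)))
    (hi : σ.toClass C (x, i) ∈ W) :
    ∃ y ∈ W, σ.classSpan C (σ.toClass C (x, i)) ∪ σ.classSpan C (σ.toClass C (x, j)) ⊆
      σ.classSpan C y := by
  classical
  obtain ⟨p, hp⟩ := Joined.of_conn hconn _ _ rfl rfl hi
  -- Feedback freedom is about paths; shortcutting the walk to a path keeps its nodes among those of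
  -- the walk, hence in `W`.
  obtain ⟨z, hz, hspan⟩ := hff n σ C hC x i j p.bypass p.bypass_isPath
  simp only [span_eq_classSpan] at hspan
  exact ⟨_, hp z (p.support_bypass_subset_support hz), hspan⟩

/-- In a connected set of classes, the spans of the classes of all the instances of a variable
are covered by the span of one class. -/
theorem exists_forall_span_subset (hff : M.FeedbackFree CC) (hC : ∀ k, C k ⊆ CC)
    {W : Set (σ.Classes C)} (hne : W.Nonempty)
    (hconn : ∀ a ∈ W, ∀ b ∈ W, (M.template CC).Conn (σ.network C CC) W a b) (x : V) :
    ∃ y ∈ W, ∀ i, σ.toClass C (x, i) ∈ W →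
      σ.classSpan C (σ.toClass C (x, i)) ⊆ σ.classSpan C y := by
  set T : Set (Fin (n + 1)) :=
    {t | ∃ i, σ.toClass C (x, i) ∈ W ∧ t ∈ σ.classSpan C (σ.toClass C (x, i))}
  rcases T.eq_empty_or_nonempty with hT | hT
  · obtain ⟨y, hy⟩ := hne
    refine ⟨y, hy, fun i hi t ht => ?_⟩
    have : t ∈ T := ⟨i, hi, ht⟩
    simp [hT] at this
  -- A span that contains the first and the last instant of `T` contains all of `T`, being an
  -- interval.
  obtain ⟨s, ⟨i, hi, hs⟩, hmin⟩ := T.toFinite.exists_minimal hT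
  obtain ⟨t, ⟨j, hj, ht⟩, hmax⟩ := T.toFinite.exists_maximal hT
  obtain ⟨y, hy, hspan⟩ := exists_span_subset hff hC (hconn _ hi _ hj) hi
  refine ⟨y, hy, fun k hk r hr => ?_⟩
  have hrT : r ∈ T := ⟨k, hk, hr⟩
  refine (ordConnected_classSpan y).out (hspan (Or.inl hs)) (hspan (Or.inr ht)) ⟨?_, ?_⟩
  · exact (le_total s r).elim id (hmin hrT)
  · exact (le_total r t).elim id (hmax hrT)

theorem exists_hasWidth [Finite V] (hff : M.FeedbackFree CC) (hC : ∀ k, C k ⊆ CC)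
    {W : Set (σ.Classes C)} {d : ℕ} (hne : W.Nonempty)
    (hconn : ∀ a ∈ W, ∀ b ∈ W, (M.template CC).Conn (σ.network C CC) W a b)
    (hW : σ.HasWidth C W (d + 1)) :
    ∃ y : V → σ.Classes C, (∀ x, y x ∈ W) ∧ ∀ c ⊆ W \ Set.range y, σ.HasWidth C c d := by
  choose y hyW hy using exists_forall_span_subset hff hC hne hconn
  refine ⟨y, hyW, fun c hc t => ?_⟩
  rcases Set.eq_empty_or_nonempty {q ∈ c | t ∈ σ.classSpan C q} with h | ⟨q, hq, ht⟩
  · simp [h]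
  obtain ⟨x, i, rfl⟩ := exists_toClass q
  -- The inclusion is strict: the deleted class `y x` covers the span of the remaining class of `(x,
  -- i)`, so it is alive at `t` too.
  have hlt : {q ∈ c | t ∈ σ.classSpan C q}.ncard < {q ∈ W | t ∈ σ.classSpan C q}.ncard := by
    refine Set.ncard_lt_ncard ⟨fun q hq => ⟨(hc hq.1).1, hq.2⟩, fun hsub => ?_⟩ (Set.toFinite _)
    exact (hc (hsub ⟨hyW x, hy x i (hc hq).1 ht⟩).1).2 ⟨x, rfl⟩
  have := hW t
  omega

theorem solutions_network_mem [Inhabited D] [Finite V] (hff : M.FeedbackFree CC)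
    (hC : ∀ k, C k ⊆ CC) :
    (M.template CC).solutions (σ.network C CC) (fun v => σ.toClass C (v, Fin.last n)) Set.univ ∈
      Set.sInter '' 𝒫 ((M.template CC).family V (Nat.card V) V) :=
  Template.solutions_univ_mem (σ.HasWidth C) (fun _ => eq_empty_of_hasWidth_zero)
    (fun _ _ => exists_hasWidth hff hC) hasWidth_card _ _

/-- The network omits `C 0`, as does the computation graph. Since the values at instant 0 are fixed,
`h₀` makes up for this. -/
theorem mem_solutions_network_iff [Finite V] (hC : ∀ k, C k ⊆ CC)
    (h₀ : ∀ c ∈ C 0, ∀ l ∈ c.literals, l.Holds fun v => (M.init_val v : D)) (g : V → D) :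
    g ∈ (M.template CC).solutions (σ.network C CC) (fun v => σ.toClass C (v, Fin.last n))
      Set.univ ↔ (σ.hist C).Realize g := by
  rw [realize_hist]
  have htrans : ∀ (k : Fin n) (l : Literal S (V ⊕ V)), l ∈ M.transLiterals (σ.act k) →
      l ∈ M.templateLiterals CC := fun k l hl => Or.inl (Or.inl (Set.mem_iUnion.2 ⟨_, hl⟩))
  have hver : ∀ k : Fin n, ∀ c ∈ C k.succ, ∀ l ∈ c.literals,
      l.map Sum.inr ∈ M.templateLiterals CC :=
    fun k c hc l hl => Or.inl (Or.inr (Set.mem_biUnion (hC _ hc) ⟨l, hl, rfl⟩))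
  constructor
  · rintro ⟨β, hβ, hK⟩
    have hinit : ∀ v, β (σ.toClass C (v, 0)) = M.init_val v := fun v =>
      hK (⟨M.initLiteral v, Or.inr ⟨v, rfl⟩⟩, _) (Or.inr ⟨v, rfl, rfl⟩)
        fun _ _ => Or.inl trivial
    refine ⟨fun k v => β (σ.toClass C (v, k)), funext hβ, hinit, fun k => ?_, fun k l hl => ?_⟩
    · refine Fin.cases ?_ (fun k c hc l hl => ?_) k
      · simpa only [hinit] using h₀
      · have h : (l.map Sum.inr).Holds _ :=
          hK (⟨l.map Sum.inr, hver k c hc l hl⟩, σ.toClass C ∘ inst k)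
            (Or.inl ⟨k, rfl, Or.inr ⟨c, hc, l, hl, rfl⟩⟩) fun _ _ => Or.inl trivial
        rw [Literal.holds_map] at h
        exact h
    · refine Literal.Holds.congr ?_ (hK (⟨l, htrans k l hl⟩, σ.toClass C ∘ inst k)
        (Or.inl ⟨k, rfl, Or.inl hl⟩) fun _ _ => Or.inl trivial)
      rintro (v | v) - <;> rfl
  · rintro ⟨β, rfl, h₁, h₂, h₃⟩
    -- A valuation of the instances that satisfies the equality literals is constant on classes, so
    -- it descends to the nodes of the network.
    have hβ : ∀ p q : V × Fin (n + 1), σ.EqClass C p q → β p.2 p.1 = β q.2 q.1 := by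
      intro p q h
      induction h with
      | rel p q h =>
        suffices h' : (Literal.eqVar p q : Literal S _).Holds fun p : V × Fin (n + 1) => β p.2 p.1 from h'
        obtain ⟨k, ⟨l, hl, h⟩ | ⟨c, hc, l, hl, h⟩⟩ := h
        · rw [h, Literal.holds_map]
          refine Literal.Holds.congr ?_ (h₃ k l hl)
          rintro (v | v) - <;> rfl
        · rw [h, Literal.holds_map]
          exact h₂ _ c hc l hl
      | refl => rfl
      | symm _ _ _ ih => exact ih.symm
      | trans _ _ _ _ _ ih₁ ih₂ => exact ih₁.trans ih₂
    refine ⟨Quotient.lift (fun p => β p.2 p.1) hβ, fun v => rfl, ?_⟩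
    rintro ⟨⟨l, hl'⟩, f⟩ hr -
    change l.Holds _
    rcases hr with ⟨k, hf, hl | ⟨c, hc, l', hl, h⟩⟩ | ⟨v, hv, hf⟩
    · change f = _ at hf
      subst hf
      refine Literal.Holds.congr ?_ (h₃ k l hl)
      rintro (v | v) - <;> rfl
    · change f = _ at hf
      change l = _ at h
      subst hf h
      rw [Literal.holds_map]
      exact h₂ _ c hc l' hl
    · change f = _ at hf
      change l = _ at hv
      subst hf hv
      exact h₁ v

/-- The history constraints of a feedback-free system are finitely many up to equivalence. -/
theorem _root_.DDSA.System.FeedbackFree.finite_hist [Inhabited D] [Finite A] [Finite V]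
    (hff : M.FeedbackFree CC) :
    {s : Set (V → D) | ∃ (n : ℕ) (σ : M.SymbolicRun n)
      (C : Fin (n + 1) → Finset (Constraint S V)), (∀ k, C k ⊆ CC) ∧
        s = {g | (σ.hist C).Realize g}}.Finite := by
  have := (M.finite_templateLiterals CC).to_subtype
  refine ((((M.template CC).finite_family V (Nat.card V) V).finite_subsets.image
    Set.sInter).insert ∅).subset ?_
  rintro _ ⟨n, σ, C, hC, rfl⟩
  -- If the initial valuation violates `C 0`, the history constraint is unsatisfiable; this accounts
  -- for the extra member `∅`.
  by_cases h₀ : ∀ c ∈ C 0, ∀ l ∈ c.literals, l.Holds fun v => (M.init_val v : D)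
  · right
    rw [← show (M.template CC).solutions (σ.network C CC) _ _ = {g | (σ.hist C).Realize g} from
      Set.ext (mem_solutions_network_iff hC h₀)]
    exact solutions_network_mem hff hC
  · left
    refine Set.eq_empty_of_forall_notMem fun g hg => h₀ ?_
    obtain ⟨β, -, h₁, h₂, -⟩ := (realize_hist σ C g).1 hg
    rw [← show β 0 = _ from funext h₁]
    exact h₂ 0

end Network

end SymbolicRun

end System

end DDSA

/-! ### From finitely many history constraints to a finite summary. -/

namespace DDSA

open FirstOrder FirstOrder.Language

theorem code_injective {K : Type u} {X : Type v} [Encodable K] [Encodable X] :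
    Function.Injective (code : Formula K X → ℕ) := by
  intro φ ψ h
  have h' := BoundedFormula.encoding.encode_injective (Encodable.encode_injective h)
  simpa using h'

/-- A finite relation is decided by searching a fixed list. -/
theorem exists_computable_of_finite {s : Set (ℕ × ℕ)} (hs : s.Finite) :
    ∃ f : ℕ → ℕ → Bool, Computable₂ f ∧ ∀ m n, f m n = true ↔ (m, n) ∈ s := by
  classical
  have h : PrimrecPred fun p : ℕ × ℕ => ∃ a ∈ hs.toFinset.toList, p = a := by
    have hR : PrimrecRel fun a p : ℕ × ℕ => p = a := Primrec.eq.comp Primrec.snd Primrec.fst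
    exact hR.exists_mem_list.comp (Primrec.const _) Primrec.id
  obtain ⟨hdec, hp⟩ := h
  exact ⟨fun m n => decide (∃ a ∈ hs.toFinset.toList, (m, n) = a), hp.to_comp,
    fun m n => by simp⟩

namespace System

section Snoc

variable {K : Type u} {B A V : Type*} [Finite V] {M : System K B A V} {n : ℕ}

/-- A symbolic run with one more step. -/
def SymbolicRun.snoc (σ : M.SymbolicRun n) (a : A) (b : B)
    (h : M.trans (σ.state (Fin.last n)) a = some b) : M.SymbolicRun (n + 1) where
  state := Fin.snoc (α := fun _ => B) σ.state b
  act := Fin.snoc (α := fun _ => A) σ.act a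
  start := by
    rw [← Fin.castSucc_zero, Fin.snoc_castSucc]
    exact σ.start
  step k := by
    refine Fin.lastCases ?_ (fun k => ?_) k
    · rw [Fin.succ_last, Fin.snoc_last, Fin.snoc_last, Fin.snoc_castSucc]
      exact h
    · rw [Fin.succ_castSucc, Fin.snoc_castSucc, Fin.snoc_castSucc, Fin.snoc_castSucc]
      exact σ.step k

theorem SymbolicRun.hist_snoc (σ : M.SymbolicRun n) (a : A) (b : B)
    (h : M.trans (σ.state (Fin.last n)) a = some b) (C : Fin (n + 1) → Finset (Constraint K V))
    (C' : Finset (Constraint K V)) :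
    (σ.snoc a b h).hist (Fin.snoc (α := fun _ => Finset (Constraint K V)) C C') =
      M.update (σ.hist C) a ⊓ conj C' := by
  have hσ : (σ.snoc a b h).dropLast = σ := by
    rcases σ with ⟨s, c, h₀, h₁⟩
    simp [snoc, dropLast]
  simp only [SymbolicRun.hist, hσ, Fin.snoc_last, Fin.snoc_castSucc]
  simp [snoc]

end Snoc

variable {D : Type u} [Add D] [Sub D] [LT D] [LE D] {S : Set D} {B A V : Type*} [Finite V]

/-- A system with finitely many history constraints up to equivalence has finite summary: a
finite history set with logical equivalence. -/
theorem hasFiniteSummary_of_finite [Finite B] [Encodable S] [Encodable V] (M : System S B A V)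
    (CC : Finset (Constraint S V))
    (hfin : {s : Set (V → D) | ∃ (n : ℕ) (σ : M.SymbolicRun n)
      (C : Fin (n + 1) → Finset (Constraint S V)), (∀ k, C k ⊆ CC) ∧
        s = {g | (σ.hist C).Realize g}}.Finite) : M.HasFiniteSummary CC := by
  classical
  set H := {s : Set (V → D) | ∃ (n : ℕ) (σ : M.SymbolicRun n)
      (C : Fin (n + 1) → Finset (Constraint S V)), (∀ k, C k ⊆ CC) ∧
        s = {g | (σ.hist C).Realize g}}
  -- The representative depends only on the set of models, so equivalent history constraints share
  -- one formula and `Φ` contains finitely many.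
  have hrep : ∀ s : Set (V → D), ∃ φ : Formula S V, s ∈ H → s = {g | φ.Realize g} := by
    intro s
    by_cases hs : s ∈ H
    · obtain ⟨n, σ, C, -, h⟩ := id hs
      exact ⟨_, fun _ => h⟩
    · exact ⟨M.initFormula, fun h => absurd h hs⟩
  choose rep hrep using hrep
  have hequiv : ∀ (n : ℕ) (σ : M.SymbolicRun n) (C : Fin (n + 1) → Finset (Constraint S V)),
      (∀ k, C k ⊆ CC) → Equivalent (σ.hist C) (rep {g | (σ.hist C).Realize g}) :=
    fun n σ C hC g => Set.ext_iff.1 (hrep _ ⟨n, σ, C, hC, rfl⟩) g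
  set Φ : Set (B × Formula S V) := {x | ∃ (n : ℕ) (σ : M.SymbolicRun n)
      (C : Fin (n + 1) → Finset (Constraint S V)), (∀ k, C k ⊆ CC) ∧
        x = (σ.state (Fin.last n), rep {g | (σ.hist C).Realize g})}
  have hΦ : M.IsHistorySet CC Φ := by
    refine ⟨fun n σ C hC => ⟨_, ⟨n, σ, C, hC, rfl⟩, hequiv n σ C hC⟩, ?_⟩
    rintro b φ ⟨n, σ, C, hC, h⟩
    obtain ⟨rfl, rfl⟩ := Prod.mk.inj h
    exact ⟨n, σ, C, hC, rfl, hequiv n σ C hC⟩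
  have hF : {φ : Formula S V | ∃ b, (b, φ) ∈ Φ}.Finite := by
    refine (hfin.image rep).subset ?_
    rintro φ ⟨b, n, σ, C, hC, h⟩
    exact ⟨_, ⟨n, σ, C, hC, rfl⟩, (Prod.mk.inj h).2.symm⟩
  have hFin : Finite (Formulas Φ) := hF.to_subtype
  let s : Setoid (Formulas Φ) :=
    { r := fun φ ψ => Equivalent φ.1 ψ.1
      iseqv := ⟨fun _ _ => Iff.rfl, fun h g => (h g).symm, fun h h' g => (h g).trans (h' g)⟩ }
  refine ⟨Φ, s, ⟨hΦ, fun _ _ h => h, ?_, ?_, ?_⟩, inferInstance⟩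
  -- Decidability is table lookup on the finitely many pairs of codes; injectivity of `code` makes
  -- the table faithful.
  · obtain ⟨f, hf, hfs⟩ := exists_computable_of_finite
      (((Set.toFinite {p : Formulas Φ × Formulas Φ | s p.1 p.2})).image
        fun p => (code p.1.1, code p.2.1))
    refine ⟨f, hf, fun φ ψ => (hfs _ _).trans ⟨?_, fun h => ⟨(φ, ψ), h, rfl⟩⟩⟩
    rintro ⟨⟨φ', ψ'⟩, h, heq⟩
    obtain ⟨h₁, h₂⟩ := Prod.mk.inj heq
    rwa [← Subtype.ext (code_injective h₁), ← Subtype.ext (code_injective h₂)]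
  · exact fun b φ ψ _ _ h => exists_congr h
  · intro b φ ψ hφ hψ h a b' hb' C hC
    have key : ∀ χ : Formulas Φ, (b, χ.1) ∈ Φ → ∃ χ' : Formulas Φ, (b', χ'.1) ∈ Φ ∧
        Equivalent (M.update χ.1 a ⊓ conj C) χ'.1 := by
      intro χ hχ
      -- Extend a run that produces `χ` by the step `a` and the set `C`; its history constraint is
      -- the required update up to equivalence.
      obtain ⟨n, σ, C', hC', rfl, he⟩ := hΦ.2 _ _ hχ
      obtain ⟨χ', hχ', he'⟩ := hΦ.1 (n + 1) (σ.snoc a b' hb')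
        (Fin.snoc (α := fun _ => Finset (Constraint S V)) C' C) (by
          intro k
          refine Fin.lastCases ?_ (fun k => ?_) k
          · rwa [Fin.snoc_last]
          · rw [Fin.snoc_castSucc]
            exact hC' k)
      rw [SymbolicRun.hist_snoc] at he'
      have hlast : (σ.snoc a b' hb').state (Fin.last (n + 1)) = b' := Fin.snoc_last (α := fun _ => B) _ _
      rw [hlast] at hχ'
      exact ⟨⟨χ', _, hχ'⟩, hχ', fun g =>
        (update_inf_conj_equivalent (fun g => (he g).symm) a C g).trans (he' g)⟩
    obtain ⟨φ', hφ', he⟩ := key φ hφ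
    obtain ⟨ψ', hψ', he'⟩ := key ψ hψ
    exact ⟨φ', ψ', hφ', hψ', he, he', fun g =>
      (he g).symm.trans ((update_inf_conj_equivalent h a C g).trans (he' g))⟩

end System

end DDSA

theorem mainTheorem6 {D : Type*} [AddCommGroup D] [LinearOrder D] [IsOrderedAddMonoid D]
    (S : Set D) [Encodable S]
    {B A V : Type*} [Finite B] [Finite A] [Finite V] [Encodable V]
    (M : DDSA.System S B A V) (CC : Finset (DDSA.Constraint S V))
    (hff : M.FeedbackFree CC) :
    M.HasFiniteSummary CC := by
  -- A filler for nodes and argument places whose value does not matter.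
  have : Inhabited D := ⟨0⟩
  exact M.hasFiniteSummary_of_finite CC hff.finite_hist
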